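/- Let $(s(n))_{n\ge 0}$ be Stern's diatomic sequence, defined by $s(0)=0$, $s(1)=1$ and, for $n\ge 0$, $s(2n)=s(n)$, $s(2n+1)=s(n)+s(n+1)$, and let $S(z)=\sum_{n\ge 0}s(n)z^n\in\mathbb{C}[[z]]$ be its generating function (Stern's function). Then $zS(z)-(1+z+z^2)S(z^2)=0$. There is exactly one nonzero power series $F(z)\in\mathbb{C}[[z]]$ all of whose coefficients lie in $\{0,1\}$ and which satisfies $$F(z)-(1+z+z^2)F(z^4)+z^4F(z^{16})=0$$ (the 0-1 Dilcher--Stolarsky function). The functions $S(z)$ and $F(z)$, regarded as elements of the field of formal Laurent series $\mathbb{C}((z))$, are algebraically independent over $\mathbb{C}(z)$; equivalently, $$\operatorname{trdeg}_{\mathbb{C}(z)}\mathbb{C}(z)(S(z),F(z))=2.$$ -/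

import Mathlib

open PowerSeries LaurentSeries

/-- The field `ℂ((z))` of formal Laurent series as an extension of the field `ℂ(z)` of rational
functions: rational functions are expanded in powers of `z`. (This is Mathlib's embedding, which
is only a scoped instance there.) -/
noncomputable instance ratFuncAlgebraLaurentSeries : Algebra (RatFunc ℂ) ℂ⸨X⸩ :=
  RatFunc.liftAlgebra (R := ℂ) (L := ℂ⸨X⸩)

instance isScalarTower_ratFunc_laurentSeries :
    IsScalarTower (Polynomial ℂ) (RatFunc ℂ) ℂ⸨X⸩ :=
  RatFunc.isScalarTower_liftAlgebra (R := ℂ) (L := ℂ⸨X⸩)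

/-- Stern's diatomic sequence: `s 0 = 0`, `s 1 = 1`, `s (2 n) = s n`,
`s (2 n + 1) = s n + s (n + 1)` (see `stern_two_mul` and `stern_two_mul_add_one`). -/
def stern : ℕ → ℕ
  | 0 => 0
  | 1 => 1
  | n + 2 =>
    if n % 2 = 0 then stern (n / 2 + 1) else stern (n / 2 + 1) + stern (n / 2 + 2)
  termination_by n => n
  decreasing_by all_goals omega

theorem stern_zero : stern 0 = 0 := by
  simp [stern]

theorem stern_one : stern 1 = 1 := by
  simp [stern]

theorem stern_two_mul (n : ℕ) : stern (2 * n) = stern n := by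
  rcases n with _ | n
  · rfl
  · rw [show 2 * (n + 1) = 2 * n + 2 by ring, stern]
    simp

theorem stern_two_mul_add_one (n : ℕ) :
    stern (2 * n + 1) = stern n + stern (n + 1) := by
  rcases n with _ | n
  · simp [stern]
  · rw [show 2 * (n + 1) + 1 = (2 * n + 1) + 2 by ring, stern, if_neg (by omega)]
    rw [show (2 * n + 1) / 2 = n by omega]

/-- Stern's function `S(z) = ∑ s(n) zⁿ`, as a formal power series over `ℂ`. -/
noncomputable def sternSeries : ℂ⟦X⟧ :=
  PowerSeries.mk fun n => (stern n : ℂ)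

/-- `F` is a 0-1 Dilcher–Stolarsky function: a nonzero power series with coefficients in `{0, 1}`
satisfying `F(z) - (1 + z + z²) F(z⁴) + z⁴ F(z¹⁶) = 0`. Here `PowerSeries.expand m` is the
substitution `z ↦ zᵐ`. -/
def IsDilcherStolarsky (F : ℂ⟦X⟧) : Prop :=
  F ≠ 0 ∧ (∀ n : ℕ, coeff n F = 0 ∨ coeff n F = 1) ∧
    F - (1 + X + X ^ 2) * expand 4 (by norm_num) F + X ^ 4 * expand 16 (by norm_num) F = 0

/-!
Let `xₙ = exp (-(1 / 4) ^ n)`, so that `xₙ → 1` and `z ↦ z⁴` takes `xₙ₊₁` to `xₙ`. The functional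
equations control the growth along this sequence: `|p(xₙ₊₁) / p(xₙ)|` tends to `(1 / 4) ^ m` for a
polynomial `p` vanishing to order `m` at `1`, the ratio of `S` tends to `3 · 3 = 9`, and the ratio
of `F` tends to the solution `ρ = φ²` of `ρ = 3 - 1 / ρ` that is at least `1`, where `φ` is the
golden ratio. Thus `p(z) S(z)^i F(z)^j` has growth ratio `(1 / 4) ^ m * 9 ^ i * φ ^ (2 * j)`. No
positive power of `φ` is rational, and `4` and `9` are coprime, so this number determines `i` and
`j`: in a nontrivial polynomial relation between `S` and `F`, the term with the largest growth
ratio could not be cancelled by the others.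

The functional equation determines `F` up to its constant coefficient, so every nonzero solution is
a multiple of the 0-1 solution, whose values on `(0, 1)` are positive and increasing; this
monotonicity keeps the ratios of `F` away from the other root `1 / φ²`.
-/

/-! ### The functional equations on coefficients -/

section FunctionalEquations

variable {R : Type*} [CommRing R]

theorem coeff_X_pow_mul_expand {p d : ℕ} (hp : p ≠ 0) (hd : d < p) (n : ℕ) (F : R⟦X⟧) :
    coeff n (X ^ d * expand p hp F) = if n % p = d then coeff (n / p) F else 0 := by
  have hn := Nat.div_add_mod n p
  rw [coeff_X_pow_mul']
  split_ifs with hdn hmod hmod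
  · rw [← hmod, ← Nat.eq_sub_of_add_eq hn, coeff_expand_mul]
  · rw [coeff_expand_of_not_dvd]
    rintro ⟨k, hk⟩
    rw [show n = d + p * k by omega, Nat.add_mul_mod_self_left, Nat.mod_eq_of_lt hd] at hmod
    exact hmod rfl
  · exact absurd (hmod ▸ Nat.mod_le n p) hdn
  · rfl

theorem sternSeries_functional_equation :
    X * sternSeries - (1 + X + X ^ 2) * expand 2 (by norm_num) sternSeries = 0 := by
  have hsplit : (1 + X + X ^ 2) * expand 2 two_ne_zero sternSeries =
      X ^ 0 * expand 2 two_ne_zero ((1 + X) * sternSeries) +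
        X ^ 1 * expand 2 two_ne_zero sternSeries := by
    rw [map_mul, map_add, map_one, expand_X]
    ring
  rw [sub_eq_zero, hsplit]
  ext n
  rw [map_add, coeff_X_pow_mul_expand two_ne_zero zero_lt_two,
    coeff_X_pow_mul_expand two_ne_zero one_lt_two, add_mul, one_mul, map_add]
  rcases n with _ | n
  · simp [sternSeries, stern_zero]
  obtain ⟨k, rfl | rfl⟩ := n.even_or_odd'
  · rw [if_neg (by omega), if_pos (by omega), show (2 * k + 1) / 2 = k by omega]
    simp [sternSeries, coeff_succ_X_mul, stern_two_mul]
  · rw [if_pos (by omega), if_neg (by omega), show (2 * k + 1 + 1) / 2 = k + 1 by omega]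
    simp [sternSeries, coeff_succ_X_mul, stern_two_mul_add_one, add_comm (stern k : ℂ)]

/-- The functional equation of the Dilcher–Stolarsky functions, over an arbitrary ring and without
any condition on the coefficients. -/
def DilcherStolarskyEquation (F : R⟦X⟧) : Prop :=
  F - (1 + X + X ^ 2) * expand 4 (by norm_num) F + X ^ 4 * expand 16 (by norm_num) F = 0

theorem dilcherStolarskyEquation_iff_coeff {F : R⟦X⟧} :
    DilcherStolarskyEquation F ↔ ∀ n, coeff n F =
      (if n % 4 = 3 then 0 else coeff (n / 4) F) - if n % 16 = 4 then coeff (n / 16) F else 0 := by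
  have hcoeff₄ (n : ℕ) : coeff n ((1 + X + X ^ 2) * expand 4 four_ne_zero F) =
      if n % 4 = 3 then 0 else coeff (n / 4) F := by
    have hd (d : ℕ) (hd : d < 4) := coeff_X_pow_mul_expand four_ne_zero hd n F
    have hsum : (1 + X + X ^ 2 : R⟦X⟧) = X ^ 0 + X ^ 1 + X ^ 2 := by ring
    rw [hsum, add_mul, add_mul, map_add, map_add, hd 0 (by norm_num), hd 1 (by norm_num),
      hd 2 (by norm_num)]
    have hlt : n % 4 < 4 := Nat.mod_lt n four_pos
    interval_cases n % 4 <;> simp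
  rw [DilcherStolarskyEquation, PowerSeries.ext_iff]
  refine forall_congr' fun n => ?_
  rw [map_add, map_sub, map_zero, hcoeff₄, coeff_X_pow_mul_expand (by norm_num) (by norm_num),
    sub_add, sub_eq_zero]

namespace DilcherStolarskyEquation

theorem smul {F : R⟦X⟧} (hF : DilcherStolarskyEquation F) (c : R) :
    DilcherStolarskyEquation (c • F) := by
  rw [DilcherStolarskyEquation] at hF ⊢
  rw [map_smul, map_smul, mul_smul_comm, mul_smul_comm, ← smul_sub, ← smul_add, hF, smul_zero]

theorem ext_coeff_zero {F G : R⟦X⟧} (hF : DilcherStolarskyEquation F)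
    (hG : DilcherStolarskyEquation G) (h : coeff 0 F = coeff 0 G) : F = G := by
  rw [dilcherStolarskyEquation_iff_coeff] at hF hG
  ext n
  induction n using Nat.strong_induction_on with
  | _ n ih =>
    rcases n.eq_zero_or_pos with rfl | hn
    · exact h
    · rw [hF, hG, ih (n / 4) (by omega), ih (n / 16) (by omega)]

end DilcherStolarskyEquation

/-- The coefficients of the 0-1 Dilcher–Stolarsky function. The functional equation reads
`a n = [n % 4 ≠ 3] * a (n / 4) - [n % 16 = 4] * a (n / 16)`; when `n % 16 = 4`, the two terms on the
right cancel. -/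
def dilcherStolarskyCoeff (n : ℕ) : ℕ :=
  if n = 0 then 1
  else if n % 4 = 3 ∨ n % 16 = 4 then 0
  else dilcherStolarskyCoeff (n / 4)
  termination_by n
  decreasing_by omega

theorem dilcherStolarskyCoeff_zero : dilcherStolarskyCoeff 0 = 1 := by
  rw [dilcherStolarskyCoeff, if_pos rfl]

theorem dilcherStolarskyCoeff_eq_ite (n : ℕ) :
    dilcherStolarskyCoeff n =
      if n % 4 = 3 ∨ n % 16 = 4 then 0 else dilcherStolarskyCoeff (n / 4) := by
  rcases n.eq_zero_or_pos with rfl | hn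
  · rfl
  · rw [dilcherStolarskyCoeff, if_neg hn.ne']

theorem dilcherStolarskyCoeff_le_one (n : ℕ) : dilcherStolarskyCoeff n ≤ 1 := by
  induction n using Nat.strong_induction_on with
  | _ n ih =>
    rcases n.eq_zero_or_pos with rfl | hn
    · exact dilcherStolarskyCoeff_zero.le
    · rw [dilcherStolarskyCoeff_eq_ite]
      split_ifs
      · exact zero_le_one
      · exact ih _ (by omega)

variable (R) in
/-- The 0-1 Dilcher–Stolarsky function over an arbitrary ring. -/
noncomputable def dilcherStolarskySeries : R⟦X⟧ :=
  PowerSeries.mk fun n => (dilcherStolarskyCoeff n : R)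

theorem coeff_zero_dilcherStolarskySeries : coeff 0 (dilcherStolarskySeries R) = 1 := by
  rw [dilcherStolarskySeries, coeff_mk, dilcherStolarskyCoeff_zero, Nat.cast_one]

theorem dilcherStolarskyEquation_dilcherStolarskySeries :
    DilcherStolarskyEquation (dilcherStolarskySeries R) := by
  rw [dilcherStolarskyEquation_iff_coeff]
  intro n
  simp only [dilcherStolarskySeries, coeff_mk]
  rw [dilcherStolarskyCoeff_eq_ite n]
  by_cases h₃ : n % 4 = 3
  · simp [h₃, show n % 16 ≠ 4 by omega]
  by_cases h₄ : n % 16 = 4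
  · rw [dilcherStolarskyCoeff_eq_ite (n / 4), show n / 4 / 4 = n / 16 by omega]
    simp [h₃, h₄, show ¬(n / 4 % 4 = 3 ∨ n / 4 % 16 = 4) by omega]
  · simp [h₃, h₄]

theorem DilcherStolarskyEquation.eq_smul {F : R⟦X⟧} (hF : DilcherStolarskyEquation F) :
    F = coeff 0 F • dilcherStolarskySeries R := by
  refine hF.ext_coeff_zero (dilcherStolarskyEquation_dilcherStolarskySeries.smul _) ?_
  rw [coeff_smul, coeff_zero_dilcherStolarskySeries, smul_eq_mul, mul_one]

theorem isDilcherStolarsky_dilcherStolarskySeries :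
    IsDilcherStolarsky (dilcherStolarskySeries ℂ) := by
  refine ⟨fun h => ?_, fun n => ?_, dilcherStolarskyEquation_dilcherStolarskySeries⟩
  · simpa [h] using coeff_zero_dilcherStolarskySeries (R := ℂ)
  · rcases Nat.le_one_iff_eq_zero_or_eq_one.1 (dilcherStolarskyCoeff_le_one n) with h | h <;>
      simp [dilcherStolarskySeries, h]

theorem existsUnique_isDilcherStolarsky : ∃! F : ℂ⟦X⟧, IsDilcherStolarsky F := by
  refine ⟨dilcherStolarskySeries ℂ, isDilcherStolarsky_dilcherStolarskySeries, ?_⟩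
  rintro F ⟨hF0, hF01, hF⟩
  have hF := DilcherStolarskyEquation.eq_smul hF
  rcases hF01 0 with h | h
  · exact absurd (by rw [hF, h, zero_smul]) hF0
  · rw [hF, h, one_smul]

end FunctionalEquations

/-! ### Evaluation of absolutely convergent power series -/

section Evaluation

variable {R : Type*} [NormedCommRing R]

theorem summable_norm_coeff_monomial_mul_pow (x a : R) (k : ℕ) :
    Summable fun n => ‖coeff n (PowerSeries.monomial k a) * x ^ n‖ := by
  refine (hasSum_single k fun n hn => ?_).summable
  rw [coeff_monomial, if_neg hn, zero_mul, norm_zero]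

theorem hasSum_coeff_monomial_mul_pow (x a : R) (k : ℕ) :
    HasSum (fun n => coeff n (PowerSeries.monomial k a) * x ^ n) (a * x ^ k) := by
  convert hasSum_single k fun n hn => ?_ using 1
  · rw [coeff_monomial, if_pos rfl]
  · rw [coeff_monomial, if_neg hn, zero_mul]

theorem coeff_mul_mul_pow (F G : R⟦X⟧) (x : R) (n : ℕ) :
    coeff n (F * G) * x ^ n = ∑ kl ∈ Finset.HasAntidiagonal.antidiagonal n,
      (coeff kl.1 F * x ^ kl.1) * (coeff kl.2 G * x ^ kl.2) := by
  rw [coeff_mul, Finset.sum_mul]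
  refine Finset.sum_congr rfl fun kl hkl => ?_
  rw [← Finset.HasAntidiagonal.mem_antidiagonal.1 hkl, pow_add]
  ring

variable [CompleteSpace R]

/-- The graph of evaluation at `x`: the pairs `(F, v)` such that the power series `F` converges
absolutely at `x`, with sum `v`. As it is a subalgebra, algebraic relations between power series
turn into relations between their values. -/
def evalGraph (x : R) : Subalgebra R (R⟦X⟧ × R) where
  carrier := {Fv | (Summable fun n => ‖coeff n Fv.1 * x ^ n‖) ∧
    HasSum (fun n => coeff n Fv.1 * x ^ n) Fv.2}
  mul_mem' := by
    rintro ⟨F, v⟩ ⟨G, w⟩ ⟨hF, hFv⟩ ⟨hG, hGw⟩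
    have hsum := summable_norm_sum_mul_antidiagonal_of_summable_norm hF hG
    have htsum := tsum_mul_tsum_eq_tsum_sum_antidiagonal_of_summable_norm hF hG
    rw [hFv.tsum_eq, hGw.tsum_eq] at htsum
    simp only [Set.mem_ofPred_eq, Prod.mk_mul_mk, coeff_mul_mul_pow]
    exact ⟨hsum, htsum ▸ hsum.of_norm.hasSum⟩
  add_mem' := by
    rintro ⟨F, v⟩ ⟨G, w⟩ ⟨hF, hFv⟩ ⟨hG, hGw⟩
    simp only [Set.mem_ofPred_eq, Prod.mk_add_mk, map_add, add_mul]
    exact ⟨(hF.add hG).of_nonneg_of_le (fun _ => norm_nonneg _) fun _ => norm_add_le _ _,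
      hFv.add hGw⟩
  algebraMap_mem' a := by
    have ha : algebraMap R (R⟦X⟧ × R) a = (PowerSeries.monomial 0 a, a * x ^ 0) := by
      simp [Prod.algebraMap_apply]
    rw [ha]
    exact ⟨summable_norm_coeff_monomial_mul_pow x a 0, hasSum_coeff_monomial_mul_pow x a 0⟩

variable {x : R}

theorem snd_eq_zero_of_mem_evalGraph {Fv : R⟦X⟧ × R} (h : Fv ∈ evalGraph x) (hF : Fv.1 = 0) :
    Fv.2 = 0 := by
  refine h.2.unique ?_
  simp [hF]

variable (x) in
theorem monomial_mem_evalGraph (k : ℕ) (a : R) :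
    (PowerSeries.monomial k a, a * x ^ k) ∈ evalGraph x :=
  ⟨summable_norm_coeff_monomial_mul_pow x a k, hasSum_coeff_monomial_mul_pow x a k⟩

variable (x) in
theorem X_mem_evalGraph : (X, x) ∈ evalGraph x := by
  simpa [X_eq] using monomial_mem_evalGraph x 1 1

variable (x) in
theorem coe_polynomial_mem_evalGraph (p : Polynomial R) :
    ((p : R⟦X⟧), p.eval x) ∈ evalGraph x := by
  induction p using Polynomial.induction_on' with
  | add p q hp hq => simpa using add_mem hp hq
  | monomial k a => simpa using monomial_mem_evalGraph x k a

theorem expand_mem_evalGraph {F : R⟦X⟧} {v : R} {p : ℕ} (hp : p ≠ 0)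
    (hF : (F, v) ∈ evalGraph (x ^ p)) : (expand p hp F, v) ∈ evalGraph x := by
  have hinj : Function.Injective fun n : ℕ => p * n := mul_right_injective₀ hp
  have hzero (n : ℕ) (hn : n ∉ Set.range fun n : ℕ => p * n) :
      coeff n (expand p hp F) * x ^ n = 0 := by
    rw [coeff_expand_of_not_dvd p hp _ fun ⟨k, hk⟩ => hn ⟨k, hk.symm⟩, zero_mul]
  have hcomp (n : ℕ) : coeff (p * n) (expand p hp F) * x ^ (p * n) = coeff n F * (x ^ p) ^ n := by
    rw [coeff_expand_mul, pow_mul]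
  constructor
  · rw [← hinj.summable_iff fun n hn => by rw [hzero n hn, norm_zero]]
    simpa only [Function.comp_def, hcomp] using hF.1
  · rw [← hinj.hasSum_iff hzero]
    simpa only [Function.comp_def, hcomp] using hF.2

theorem aeval_mem_evalGraph {ι : Type*} {F : ι → R⟦X⟧} {v : ι → R}
    (h : ∀ i, (F i, v i) ∈ evalGraph x) (p : MvPolynomial ι (Polynomial R)) :
    (MvPolynomial.aeval F p, p.eval₂ (Polynomial.evalRingHom x) v) ∈ evalGraph x := by
  let f : Polynomial R →+* R⟦X⟧ × R := (algebraMap _ _).prod (Polynomial.evalRingHom x)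
  have hp : p.eval₂ f (fun i => (F i, v i)) =
      (MvPolynomial.aeval F p, p.eval₂ (Polynomial.evalRingHom x) v) :=
    Prod.ext (MvPolynomial.hom_eval₂ p f (RingHom.fst _ _) _)
      (MvPolynomial.hom_eval₂ p f (RingHom.snd _ _) _)
  rw [← hp]
  exact MvPolynomial.eval₂_mem (fun d _ => coe_polynomial_mem_evalGraph x (p.coeff d)) h

end Evaluation

/-! ### Growth ratios -/

open Filter Topology

/-- The sequence `u` has growth ratio `l > 0`: its terms are eventually nonzero, and the quotients
`‖u (n + 1)‖ / ‖u n‖` tend to `l`. -/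
structure HasGrowthRatio {𝕜 : Type*} [NormedField 𝕜] (u : ℕ → 𝕜) (l : ℝ) : Prop where
  pos : 0 < l
  eventually_ne_zero : ∀ᶠ n in atTop, u n ≠ 0
  tendsto : Tendsto (fun n => ‖u (n + 1)‖ / ‖u n‖) atTop (𝓝 l)

namespace HasGrowthRatio

variable {𝕜 ι : Type*} [NormedField 𝕜] {u v : ℕ → 𝕜} {l m : ℝ}

theorem of_tendsto {c : 𝕜} (hc : c ≠ 0) (hu : Tendsto u atTop (𝓝 c)) : HasGrowthRatio u 1 where
  pos := one_pos
  eventually_ne_zero := hu.eventually_ne hc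
  tendsto := by
    have hc : ‖c‖ ≠ 0 := norm_ne_zero_iff.2 hc
    simpa [Pi.div_def, div_self hc] using (hu.comp (tendsto_add_atTop_nat 1)).norm.div hu.norm hc

theorem of_tendsto_div {c : 𝕜} (hc : c ≠ 0) (hu : ∀ n, u n ≠ 0)
    (h : Tendsto (fun n => u (n + 1) / u n) atTop (𝓝 c)) : HasGrowthRatio u ‖c‖ where
  pos := norm_pos_iff.2 hc
  eventually_ne_zero := .of_forall hu
  tendsto := by simpa only [norm_div] using h.norm

theorem mul (hu : HasGrowthRatio u l) (hv : HasGrowthRatio v m) :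
    HasGrowthRatio (fun n => u n * v n) (l * m) where
  pos := mul_pos hu.pos hv.pos
  eventually_ne_zero := by
    filter_upwards [hu.eventually_ne_zero, hv.eventually_ne_zero] with n hun hvn
    exact mul_ne_zero hun hvn
  tendsto := by
    simpa only [norm_mul, mul_div_mul_comm] using hu.tendsto.mul hv.tendsto

theorem div (hu : HasGrowthRatio u l) (hv : HasGrowthRatio v m) :
    HasGrowthRatio (fun n => u n / v n) (l / m) where
  pos := div_pos hu.pos hv.pos
  eventually_ne_zero := by
    filter_upwards [hu.eventually_ne_zero, hv.eventually_ne_zero] with n hun hvn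
    exact div_ne_zero hun hvn
  tendsto := by
    simpa only [Pi.div_def, norm_div, div_div_div_comm] using hu.tendsto.div hv.tendsto hv.pos.ne'

theorem pow (hu : HasGrowthRatio u l) (k : ℕ) : HasGrowthRatio (fun n => u n ^ k) (l ^ k) where
  pos := pow_pos hu.pos k
  eventually_ne_zero := hu.eventually_ne_zero.mono fun _ => pow_ne_zero k
  tendsto := by simpa only [norm_pow, div_pow] using hu.tendsto.pow k

theorem prod (s : Finset ι) {u : ι → ℕ → 𝕜} {l : ι → ℝ}
    (hu : ∀ i ∈ s, HasGrowthRatio (u i) (l i)) :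
    HasGrowthRatio (fun n => ∏ i ∈ s, u i n) (∏ i ∈ s, l i) where
  pos := Finset.prod_pos fun i hi => (hu i hi).pos
  eventually_ne_zero := by
    filter_upwards [s.eventually_all.2 fun i hi => (hu i hi).eventually_ne_zero] with n hn
    exact Finset.prod_ne_zero_iff.2 hn
  tendsto := by
    simpa only [norm_prod, Finset.prod_div_distrib] using
      tendsto_finsetProd s fun i hi => (hu i hi).tendsto

theorem ofReal {u : ℕ → ℝ} (hu : HasGrowthRatio u l) :
    HasGrowthRatio (fun n => (u n : ℂ)) l where
  pos := hu.pos
  eventually_ne_zero := hu.eventually_ne_zero.mono fun _ => Complex.ofReal_ne_zero.2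
  tendsto := by simpa only [Complex.norm_real] using hu.tendsto

theorem tendsto_zero [CompleteSpace 𝕜] (hu : HasGrowthRatio u l) (hl : l < 1) :
    Tendsto u atTop (𝓝 0) :=
  (summable_of_ratio_test_tendsto_lt_one hl hu.eventually_ne_zero hu.tendsto).tendsto_atTop_zero

theorem eventually_sum_ne_zero [CompleteSpace 𝕜] {s : Finset ι} (hs : s.Nonempty)
    {u : ι → ℕ → 𝕜} {l : ι → ℝ} (hu : ∀ i ∈ s, HasGrowthRatio (u i) (l i))
    (hl : Set.InjOn l s) : ∀ᶠ n in atTop, ∑ i ∈ s, u i n ≠ 0 := by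
  classical
  obtain ⟨j, hj, hmax⟩ := s.exists_max_image l hs
  have hother : Tendsto (fun n => ∑ i ∈ s.erase j, u i n / u j n) atTop (𝓝 0) := by
    rw [← Finset.sum_const_zero (s := s.erase j)]
    refine tendsto_finsetSum _ fun i hi => ?_
    obtain ⟨hij, his⟩ := Finset.mem_erase.1 hi
    have hlt : l i < l j := (hmax i his).lt_of_ne fun h => hij (hl his hj h)
    exact ((hu i his).div (hu j hj)).tendsto_zero ((div_lt_one (hu j hj).pos).2 hlt)
  have hone := (hother.const_add 1).eventually_ne (by simp : (1 + 0 : 𝕜) ≠ 0)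
  filter_upwards [hone, (hu j hj).eventually_ne_zero] with n hn hjn hsum
  refine hn ?_
  rw [← Finset.sum_div, ← div_self hjn, ← add_div, Finset.add_sum_erase s (fun i => u i n) hj,
    hsum, zero_div]

theorem polynomial_eval {x : ℕ → 𝕜} {a : 𝕜} {μ : ℝ} (hx : Tendsto x atTop (𝓝 a))
    (hxa : HasGrowthRatio (fun n => x n - a) μ) {p : Polynomial 𝕜} (hp : p ≠ 0) :
    HasGrowthRatio (fun n => p.eval (x n)) (μ ^ p.rootMultiplicity a) := by
  obtain ⟨q, hpq, hq⟩ := p.exists_eq_pow_rootMultiplicity_mul_and_not_dvd hp a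
  rw [Polynomial.dvd_iff_isRoot, Polynomial.IsRoot.def] at hq
  have heval (n : ℕ) : p.eval (x n) = (x n - a) ^ p.rootMultiplicity a * q.eval (x n) := by
    nth_rewrite 1 [hpq]
    simp
  simpa only [heval, mul_one, Function.comp_apply] using
    (hxa.pow _).mul (of_tendsto hq ((q.continuous.tendsto a).comp hx))

end HasGrowthRatio

theorem algebraicIndependent_of_hasGrowthRatio {𝕜 ι : Type*} [NormedField 𝕜] [CompleteSpace 𝕜]
    {x : ℕ → 𝕜} {a : 𝕜} {μ : ℝ} {F : ι → 𝕜⟦X⟧} {v : ι → ℕ → 𝕜} {l : ι → ℝ}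
    (hx : Tendsto x atTop (𝓝 a)) (hxa : HasGrowthRatio (fun n => x n - a) μ)
    (hF : ∀ i n, (F i, v i n) ∈ evalGraph (x n)) (hv : ∀ i, HasGrowthRatio (v i) (l i))
    (hl : ∀ (m m' : ℕ) (d d' : ι →₀ ℕ),
      μ ^ m * d.prod (fun i k => l i ^ k) = μ ^ m' * d'.prod (fun i k => l i ^ k) → d = d') :
    AlgebraicIndependent (Polynomial 𝕜) F := by
  refine algebraicIndependent_iff.2 fun p hp => by_contra fun hp0 => ?_
  have hterm : ∀ d ∈ p.support, HasGrowthRatio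
      (fun n => (p.coeff d).eval (x n) * ∏ i ∈ d.support, v i n ^ d i)
      (μ ^ (p.coeff d).rootMultiplicity a * d.prod fun i k => l i ^ k) := fun d hd =>
    (HasGrowthRatio.polynomial_eval hx hxa (MvPolynomial.mem_support_iff.1 hd)).mul
      (HasGrowthRatio.prod _ fun i _ => (hv i).pow (d i))
  have hsum := HasGrowthRatio.eventually_sum_ne_zero (MvPolynomial.support_nonempty.2 hp0) hterm
    fun d _ d' _ h => hl _ _ d d' h
  obtain ⟨n, hn⟩ := hsum.exists
  refine hn ?_
  rw [← snd_eq_zero_of_mem_evalGraph (aeval_mem_evalGraph (fun i => hF i n) p) hp]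
  exact (MvPolynomial.eval₂_eq (Polynomial.evalRingHom (x n)) (fun i => v i n) p).symm

/-! ### Recurrences with convergent coefficients -/

theorem tendsto_zero_of_le_add_mul {e δ : ℕ → ℝ} {q : ℝ} (hq₀ : 0 ≤ q) (hq₁ : q < 1)
    (he : ∀ n, 0 ≤ e n) (hδ : Tendsto δ atTop (𝓝 0)) (h : ∀ n, e (n + 1) ≤ δ n + q * e n) :
    Tendsto e atTop (𝓝 0) := by
  refine tendsto_order.2 ⟨fun a ha => .of_forall fun n => ha.trans_le (he n), fun ε hε => ?_⟩
  have hε' : 0 < ε / 2 * (1 - q) := mul_pos (half_pos hε) (sub_pos.2 hq₁)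
  obtain ⟨N, hN⟩ := eventually_atTop.1 (hδ.eventually_lt_const hε')
  have hbound (k : ℕ) : e (N + k) ≤ ε / 2 + e N * q ^ k := by
    induction k with
    | zero => simpa using (half_pos hε).le
    | succ k ih =>
      calc e (N + k + 1) ≤ δ (N + k) + q * e (N + k) := h _
        _ ≤ ε / 2 * (1 - q) + q * (ε / 2 + e N * q ^ k) := by
          gcongr
          exact (hN _ (N.le_add_right k)).le
        _ = ε / 2 + e N * q ^ (k + 1) := by ring
  have hgeom : Tendsto (fun k : ℕ => e N * q ^ k) atTop (𝓝 0) := by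
    simpa using (tendsto_pow_atTop_nhds_zero_of_lt_one hq₀ hq₁).const_mul (e N)
  obtain ⟨K, hK⟩ := eventually_atTop.1 (hgeom.eventually_lt_const (half_pos hε))
  filter_upwards [eventually_ge_atTop (N + K)] with n hn
  obtain ⟨k, rfl⟩ := Nat.exists_eq_add_of_le (le_of_add_le_left hn)
  linarith [hbound k, hK k (by omega)]

theorem tendsto_of_eq_sub_div {r A B : ℕ → ℝ} {α β ρ c : ℝ} (hA : Tendsto A atTop (𝓝 α))
    (hB : Tendsto B atTop (𝓝 β)) (hc : 0 < c) (hr : ∀ n, c ≤ r n)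
    (h : ∀ n, r (n + 1) = A n - B n / r n) (hρ : 0 < ρ) (hfix : ρ = α - β / ρ)
    (hβ : |β| < c * ρ) : Tendsto r atTop (𝓝 ρ) := by
  have hr₀ (n : ℕ) : 0 < r n := hc.trans_le (hr n)
  have hδ : Tendsto (fun n => |A n - α| + |B n - β| / c) atTop (𝓝 0) := by
    simpa using (hA.sub_const α).abs.add ((hB.sub_const β).abs.div_const c)
  have hcontract (n : ℕ) : |r (n + 1) - ρ| ≤
      (|A n - α| + |B n - β| / c) + |β| / (c * ρ) * |r n - ρ| := by
    have hdiff : r (n + 1) - ρ =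
        (A n - α) + -((B n - β) / r n) + β / (r n * ρ) * (r n - ρ) := by
      have hrn := (hr₀ n).ne'
      rw [h]
      nth_rewrite 1 [hfix]
      field_simp
      ring
    rw [hdiff]
    refine (abs_add_three _ _ _).trans ?_
    rw [abs_neg, abs_mul, abs_div, abs_div, abs_of_pos (hr₀ n), abs_of_pos (mul_pos (hr₀ n) hρ)]
    gcongr <;> exact hr n
  refine tendsto_iff_norm_sub_tendsto_zero.2 ?_
  exact tendsto_zero_of_le_add_mul (by positivity) ((div_lt_one (by positivity)).2 hβ)
    (fun _ => norm_nonneg _) hδ hcontract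

theorem tendsto_succ_div_of_three_term_recurrence {w A B : ℕ → ℝ} {α β ρ c : ℝ}
    (hA : Tendsto A atTop (𝓝 α)) (hB : Tendsto B atTop (𝓝 β)) (hw : ∀ n, 0 < w n) (hc : 0 < c)
    (hcw : ∀ n, c * w n ≤ w (n + 1)) (h : ∀ n, w (n + 2) = A n * w (n + 1) - B n * w n)
    (hρ : 0 < ρ) (hfix : ρ = α - β / ρ) (hβ : |β| < c * ρ) :
    Tendsto (fun n => w (n + 1) / w n) atTop (𝓝 ρ) := by
  refine tendsto_of_eq_sub_div hA hB hc (fun n => (le_div_iff₀ (hw n)).2 (hcw n)) (fun n => ?_)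
    hρ hfix hβ
  rw [h, sub_div, mul_div_cancel_right₀ _ (hw (n + 1)).ne', div_div_eq_mul_div]

/-! ### Multiplicative independence of `4`, `9` and the golden ratio -/

section GoldenRatio

open Real

theorem irrational_goldenRatio_pow {n : ℕ} (hn : n ≠ 0) : Irrational (goldenRatio ^ n) := by
  obtain ⟨k, rfl⟩ := Nat.exists_eq_succ_of_ne_zero hn
  rw [Nat.succ_eq_add_one, ← goldenRatio_mul_fib_succ_add_fib]
  exact (goldenRatio_irrational.mul_natCast (Nat.fib_pos.2 k.succ_pos).ne').add_natCast _

theorem goldenRatio_sq_eq_three_sub : goldenRatio ^ 2 = 3 - 1 / goldenRatio ^ 2 := by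
  have hφ : goldenRatio ^ 2 ≠ 0 := by positivity
  rw [eq_sub_iff_add_eq, ← mul_left_inj' hφ, add_mul, div_mul_cancel₀ _ hφ]
  linear_combination (goldenRatio ^ 2 + goldenRatio - 1) * goldenRatio_sq

theorem eq_of_natCast_mul_goldenRatio_pow_eq {a b k l : ℕ} (ha : a ≠ 0) (hb : b ≠ 0)
    (h : a * goldenRatio ^ k = b * goldenRatio ^ l) : k = l := by
  wlog hkl : k ≤ l generalizing a b k l
  · exact (this hb ha h.symm (le_of_not_ge hkl)).symm
  obtain ⟨d, rfl⟩ := Nat.exists_eq_add_of_le hkl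
  rw [pow_add, mul_left_comm, mul_comm (a : ℝ)] at h
  have hab : (a : ℝ) = b * goldenRatio ^ d := mul_left_cancel₀ (by positivity) h
  by_contra hd
  exact ((irrational_goldenRatio_pow (by omega : d ≠ 0)).natCast_mul hb).ne_nat a hab.symm

theorem eq_of_pow_mul_pow_eq_of_coprime {p q : ℕ} (hpq : p.Coprime q) (hq : 1 < q)
    {a b i j : ℕ} (h : p ^ a * q ^ i = p ^ b * q ^ j) : i = j := by
  wlog hij : i ≤ j generalizing a b i j
  · exact (this h.symm (le_of_not_ge hij)).symm
  obtain ⟨d, rfl⟩ := Nat.exists_eq_add_of_le hij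
  have hpa : p ^ a = p ^ b * q ^ d := by
    refine Nat.eq_of_mul_eq_mul_right (pow_pos (by omega : 0 < q) i) ?_
    rw [h]
    ring
  have hd : q ^ d = 1 :=
    Nat.eq_one_of_dvd_coprimes (hpq.pow a d) (Dvd.intro_left _ hpa.symm) dvd_rfl
  simpa [hq.ne'] using hd

theorem eq_and_eq_of_four_nine_goldenRatio {m m' i i' j j' : ℕ}
    (h : (1 / 4 : ℝ) ^ m * (9 ^ i * (goldenRatio ^ 2) ^ j) =
      (1 / 4) ^ m' * (9 ^ i' * (goldenRatio ^ 2) ^ j')) : i = i' ∧ j = j' := by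
  have hcleared : ((4 ^ m' * 9 ^ i : ℕ) : ℝ) * goldenRatio ^ (2 * j) =
      (4 ^ m * 9 ^ i' : ℕ) * goldenRatio ^ (2 * j') := by
    rw [pow_mul, pow_mul]
    generalize goldenRatio ^ 2 = x at h ⊢
    push_cast
    rw [one_div, inv_pow, inv_pow] at h
    field_simp at h
    linear_combination h
  have hj := eq_of_natCast_mul_goldenRatio_pow_eq (by positivity) (by positivity) hcleared
  rw [hj, mul_left_inj' (by positivity), Nat.cast_inj] at hcleared
  have hcoprime : Nat.Coprime 4 9 := by norm_num
  exact ⟨eq_of_pow_mul_pow_eq_of_coprime hcoprime (by norm_num) hcleared, by omega⟩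

end GoldenRatio

/-! ### Power series with natural number coefficients at real points -/

/-- The sum `∑ aₙ xⁿ` at a real number `x`. Growth ratios are computed for these real values, since
positivity and monotonicity are available there; the value is junk unless the series converges. -/
noncomputable def natSeriesSum (a : ℕ → ℕ) (x : ℝ) : ℝ := ∑' n, (a n : ℝ) * x ^ n

section NatSeriesSum

variable {a : ℕ → ℕ} {k : ℕ} {x y : ℝ}

theorem summable_natSeries (ha : (fun n => (a n : ℝ)) =O[atTop] fun n => ((n ^ k : ℕ) : ℝ))
    (hx : ‖x‖ < 1) : Summable fun n => (a n : ℝ) * x ^ n :=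
  (summable_norm_mul_geometric_of_norm_lt_one hx ha).of_norm

theorem natSeriesSum_pos (ha : (fun n => (a n : ℝ)) =O[atTop] fun n => ((n ^ k : ℕ) : ℝ))
    (hx₀ : 0 < x) (hx₁ : x < 1) {m : ℕ} (hm : a m ≠ 0) : 0 < natSeriesSum a x := by
  refine (summable_natSeries ha ?_).tsum_pos (fun n => by positivity) m (by positivity)
  rwa [Real.norm_of_nonneg hx₀.le]

theorem natSeriesSum_mono (ha : (fun n => (a n : ℝ)) =O[atTop] fun n => ((n ^ k : ℕ) : ℝ))
    (hx : 0 ≤ x) (hxy : x ≤ y) (hy : y < 1) : natSeriesSum a x ≤ natSeriesSum a y := by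
  refine (summable_natSeries ha ?_).tsum_le_tsum (fun n => by gcongr) (summable_natSeries ha ?_)
  · rw [Real.norm_of_nonneg hx]
    exact hxy.trans_lt hy
  · rwa [Real.norm_of_nonneg (hx.trans hxy)]

theorem mk_natCast_mem_evalGraph
    (ha : (fun n => (a n : ℝ)) =O[atTop] fun n => ((n ^ k : ℕ) : ℝ)) (hx : ‖x‖ < 1) :
    (PowerSeries.mk fun n => (a n : ℂ), (natSeriesSum a x : ℂ)) ∈ evalGraph (x : ℂ) := by
  have hxC : ‖(x : ℂ)‖ < 1 := by rwa [Complex.norm_real]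
  constructor
  · simpa only [coeff_mk] using summable_norm_mul_geometric_of_norm_lt_one hxC ha
  · simpa [natSeriesSum] using
      Complex.hasSum_ofReal.2 (summable_natSeries ha hx).hasSum

end NatSeriesSum

/-! ### Growth along a sequence tending to `1` -/

/-- A sequence in `(0, 1)` tending to `1` in which each term is the fourth power of the next, so
that `z ↦ z⁴` steps back along the sequence. -/
noncomputable def radialPoint (n : ℕ) : ℝ := Real.exp (-(1 / 4) ^ n)

theorem radialPoint_pos (n : ℕ) : 0 < radialPoint n := Real.exp_pos _

theorem radialPoint_lt_one (n : ℕ) : radialPoint n < 1 := Real.exp_lt_one_iff.2 (by simp)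

theorem norm_radialPoint_lt_one (n : ℕ) : ‖radialPoint n‖ < 1 := by
  rw [Real.norm_of_nonneg (radialPoint_pos n).le]
  exact radialPoint_lt_one n

theorem radialPoint_succ_pow_four (n : ℕ) : radialPoint (n + 1) ^ 4 = radialPoint n := by
  rw [radialPoint, radialPoint, ← Real.exp_nat_mul]
  congr 1
  push_cast
  ring

theorem tendsto_radialPoint : Tendsto radialPoint atTop (𝓝 1) := by
  have h : Tendsto (fun n : ℕ => -(1 / 4 : ℝ) ^ n) atTop (𝓝 (-0)) :=
    (tendsto_pow_atTop_nhds_zero_of_lt_one (by norm_num) (by norm_num)).neg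
  rw [← Real.exp_zero, ← neg_zero]
  exact (Real.continuous_exp.tendsto _).comp h

theorem tendsto_comp_radialPoint_add {f : ℝ → ℝ} (hf : ContinuousAt f 1) (k : ℕ) :
    Tendsto (fun n => f (radialPoint (n + k))) atTop (𝓝 (f 1)) :=
  hf.tendsto.comp (tendsto_radialPoint.comp (tendsto_add_atTop_nat k))

theorem hasGrowthRatio_radialPoint_sub_one :
    HasGrowthRatio (fun n => radialPoint n - 1) (1 / 4) := by
  have hne (n : ℕ) : radialPoint n - 1 ≠ 0 := (sub_neg.2 (radialPoint_lt_one n)).ne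
  have h : Tendsto (fun n => (radialPoint (n + 1) - 1) / (radialPoint n - 1)) atTop
      (𝓝 ((1 + 1 + 1 ^ 2 + 1 ^ 3)⁻¹)) := by
    refine (tendsto_comp_radialPoint_add (f := fun x => (1 + x + x ^ 2 + x ^ 3)⁻¹) ?_ 1).congr
      fun n => ?_
    · exact ContinuousAt.inv₀ (by fun_prop) (by norm_num)
    · have hpos := radialPoint_pos (n + 1)
      rw [← radialPoint_succ_pow_four n, eq_div_iff, inv_mul_eq_iff_eq_mul₀ (by positivity)]
      · ring
      · rw [radialPoint_succ_pow_four]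
        exact hne n
  convert HasGrowthRatio.of_tendsto_div (by norm_num) hne h
  norm_num

theorem stern_le (n : ℕ) : stern n ≤ n := by
  induction n using Nat.strong_induction_on with
  | _ n ih =>
    obtain ⟨k, rfl | rfl⟩ := n.even_or_odd'
    · rcases k.eq_zero_or_pos with rfl | hk
      · exact stern_zero.le
      · rw [stern_two_mul]
        exact (ih k (by omega)).trans (by omega)
    · rcases k.eq_zero_or_pos with rfl | hk
      · exact stern_one.le
      · rw [stern_two_mul_add_one]
        have hk₀ := ih k (by omega)
        have hk₁ := ih (k + 1) (by omega)
        omega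

theorem stern_isBigO : (fun n => (stern n : ℝ)) =O[atTop] fun n => ((n ^ 1 : ℕ) : ℝ) :=
  .of_norm_le fun n => by simpa using stern_le n

theorem dilcherStolarskyCoeff_isBigO :
    (fun n => (dilcherStolarskyCoeff n : ℝ)) =O[atTop] fun n => ((n ^ 0 : ℕ) : ℝ) :=
  .of_norm_le fun n => by simpa using dilcherStolarskyCoeff_le_one n

theorem sternSeries_mem_evalGraph {x : ℝ} (hx : ‖x‖ < 1) :
    (sternSeries, (natSeriesSum stern x : ℂ)) ∈ evalGraph (x : ℂ) :=
  mk_natCast_mem_evalGraph stern_isBigO hx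

theorem dilcherStolarskySeries_mem_evalGraph {x : ℝ} (hx : ‖x‖ < 1) :
    (dilcherStolarskySeries ℂ, (natSeriesSum dilcherStolarskyCoeff x : ℂ)) ∈ evalGraph (x : ℂ) :=
  mk_natCast_mem_evalGraph dilcherStolarskyCoeff_isBigO hx

theorem norm_pow_lt_one {x : ℝ} (hx : ‖x‖ < 1) {p : ℕ} (hp : p ≠ 0) : ‖x ^ p‖ < 1 := by
  rw [norm_pow]
  exact pow_lt_one₀ (norm_nonneg x) hx hp

theorem mul_natSeriesSum_stern {x : ℝ} (hx : ‖x‖ < 1) :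
    x * natSeriesSum stern x = (1 + x + x ^ 2) * natSeriesSum stern (x ^ 2) := by
  have hX := X_mem_evalGraph (x : ℂ)
  have hS₂ := sternSeries_mem_evalGraph (norm_pow_lt_one hx two_ne_zero)
  rw [Complex.ofReal_pow] at hS₂
  have hmem := sub_mem (mul_mem hX (sternSeries_mem_evalGraph hx)) (mul_mem
    (add_mem (add_mem (one_mem _) hX) (pow_mem hX 2)) (expand_mem_evalGraph two_ne_zero hS₂))
  have hzero := snd_eq_zero_of_mem_evalGraph hmem sternSeries_functional_equation
  dsimp at hzero
  norm_cast at hzero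
  exact sub_eq_zero.1 hzero

theorem natSeriesSum_dilcherStolarskyCoeff {x : ℝ} (hx : ‖x‖ < 1) :
    natSeriesSum dilcherStolarskyCoeff x =
      (1 + x + x ^ 2) * natSeriesSum dilcherStolarskyCoeff (x ^ 4) -
        x ^ 4 * natSeriesSum dilcherStolarskyCoeff (x ^ 16) := by
  have hX := X_mem_evalGraph (x : ℂ)
  have hF₄ := dilcherStolarskySeries_mem_evalGraph (norm_pow_lt_one hx four_ne_zero)
  have hF₁₆ := dilcherStolarskySeries_mem_evalGraph
    (norm_pow_lt_one hx (by norm_num : (16 : ℕ) ≠ 0))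
  rw [Complex.ofReal_pow] at hF₄ hF₁₆
  have hmem := add_mem (sub_mem (dilcherStolarskySeries_mem_evalGraph hx) (mul_mem
    (add_mem (add_mem (one_mem _) hX) (pow_mem hX 2)) (expand_mem_evalGraph four_ne_zero hF₄)))
    (mul_mem (pow_mem hX 4) (expand_mem_evalGraph (by norm_num) hF₁₆))
  have hzero := snd_eq_zero_of_mem_evalGraph hmem dilcherStolarskyEquation_dilcherStolarskySeries
  dsimp at hzero
  norm_cast at hzero
  linear_combination hzero

theorem natSeriesSum_stern_pow_four {x : ℝ} (hx₀ : x ≠ 0) (hx : ‖x‖ < 1) :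
    natSeriesSum stern x =
      (1 + x + x ^ 2) * (1 + x ^ 2 + x ^ 4) / x ^ 3 * natSeriesSum stern (x ^ 4) := by
  have h₁ := mul_natSeriesSum_stern hx
  have h₂ := mul_natSeriesSum_stern (norm_pow_lt_one hx two_ne_zero)
  norm_num only [← pow_mul] at h₂
  field_simp
  linear_combination x ^ 2 * h₁ + (1 + x + x ^ 2) * h₂

theorem natSeriesSum_stern_radialPoint_pos (n : ℕ) : 0 < natSeriesSum stern (radialPoint n) :=
  natSeriesSum_pos stern_isBigO (radialPoint_pos n) (radialPoint_lt_one n)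
    (stern_one.trans_ne one_ne_zero)

theorem natSeriesSum_dilcherStolarskyCoeff_radialPoint_pos (n : ℕ) :
    0 < natSeriesSum dilcherStolarskyCoeff (radialPoint n) :=
  natSeriesSum_pos dilcherStolarskyCoeff_isBigO (radialPoint_pos n) (radialPoint_lt_one n)
    (dilcherStolarskyCoeff_zero.trans_ne one_ne_zero)

theorem hasGrowthRatio_stern :
    HasGrowthRatio (fun n => natSeriesSum stern (radialPoint n)) 9 := by
  have hne (n : ℕ) := (natSeriesSum_stern_radialPoint_pos n).ne'
  have h : Tendsto
      (fun n => natSeriesSum stern (radialPoint (n + 1)) / natSeriesSum stern (radialPoint n))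
      atTop (𝓝 ((1 + 1 + 1 ^ 2) * (1 + 1 ^ 2 + 1 ^ 4) / 1 ^ 3)) := by
    refine (tendsto_comp_radialPoint_add
      (f := fun x => (1 + x + x ^ 2) * (1 + x ^ 2 + x ^ 4) / x ^ 3) ?_ 1).congr fun n => ?_
    · exact ContinuousAt.div (by fun_prop) (by fun_prop) (by norm_num)
    · rw [eq_div_iff (hne n), natSeriesSum_stern_pow_four (radialPoint_pos (n + 1)).ne'
        (norm_radialPoint_lt_one (n + 1)), radialPoint_succ_pow_four]
  convert HasGrowthRatio.of_tendsto_div (by norm_num) hne h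
  norm_num

theorem natSeriesSum_dilcherStolarskyCoeff_radialPoint_le_succ (n : ℕ) :
    natSeriesSum dilcherStolarskyCoeff (radialPoint n) ≤
      natSeriesSum dilcherStolarskyCoeff (radialPoint (n + 1)) := by
  refine natSeriesSum_mono dilcherStolarskyCoeff_isBigO (radialPoint_pos n).le ?_
    (radialPoint_lt_one _)
  rw [← radialPoint_succ_pow_four n]
  exact pow_le_of_le_one (radialPoint_pos _).le (radialPoint_lt_one _).le four_ne_zero

theorem natSeriesSum_dilcherStolarskyCoeff_radialPoint_add_two (n : ℕ) :
    natSeriesSum dilcherStolarskyCoeff (radialPoint (n + 2)) =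
      (1 + radialPoint (n + 2) + radialPoint (n + 2) ^ 2) *
        natSeriesSum dilcherStolarskyCoeff (radialPoint (n + 1)) -
      radialPoint (n + 1) * natSeriesSum dilcherStolarskyCoeff (radialPoint n) := by
  have h := natSeriesSum_dilcherStolarskyCoeff (norm_radialPoint_lt_one (n + 2))
  rwa [show 16 = 4 * 4 from rfl, pow_mul, radialPoint_succ_pow_four (n + 1),
    radialPoint_succ_pow_four n] at h

theorem hasGrowthRatio_dilcherStolarskyCoeff :
    HasGrowthRatio (fun n => natSeriesSum dilcherStolarskyCoeff (radialPoint n))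
      (Real.goldenRatio ^ 2) := by
  have hpos := natSeriesSum_dilcherStolarskyCoeff_radialPoint_pos
  have hA : Tendsto (fun n => 1 + radialPoint (n + 2) + radialPoint (n + 2) ^ 2) atTop (𝓝 3) := by
    convert tendsto_comp_radialPoint_add (f := fun x => 1 + x + x ^ 2) (by fun_prop) 2
    norm_num
  have hB := tendsto_comp_radialPoint_add (f := fun x => x) (by fun_prop) 1
  have hratio := tendsto_succ_div_of_three_term_recurrence hA hB hpos one_pos
    (fun n => by simpa using natSeriesSum_dilcherStolarskyCoeff_radialPoint_le_succ n)
    natSeriesSum_dilcherStolarskyCoeff_radialPoint_add_two (by positivity)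
    goldenRatio_sq_eq_three_sub
    (by simpa using one_lt_pow₀ Real.one_lt_goldenRatio two_ne_zero)
  convert HasGrowthRatio.of_tendsto_div (by positivity) (fun n => (hpos n).ne') hratio
  rw [Real.norm_of_nonneg (by positivity)]

/-! ### Algebraic independence over the field of fractions -/

theorem algebraicIndependent_algebraMap_comp_of_isFractionRing {ι : Type*} (R K A L : Type*)
    [CommRing R] [Field K] [CommRing A] [CommRing L] [Algebra R K]
    [IsFractionRing R K] [Algebra R A] [Algebra A L] [Algebra R L] [Algebra K L]
    [IsScalarTower R A L] [IsScalarTower R K L] (hAL : Function.Injective (algebraMap A L))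
    {x : ι → A} (hx : AlgebraicIndependent R x) :
    AlgebraicIndependent K (algebraMap A L ∘ x) :=
  have : Nontrivial R := (algebraMap R K).domain_nontrivial
  have : Algebra.IsAlgebraic R K := IsLocalization.isAlgebraic K (nonZeroDivisors R)
  (hx.map' (f := IsScalarTower.toAlgHom R A L) hAL).extendScalars K

universe u v w in
theorem trdeg_adjoin_range_of_algebraicIndependent {ι : Type u} {K : Type v} {L : Type w}
    [Field K] [Field L] [Algebra K L] {x : ι → L} (hx : AlgebraicIndependent K x) :
    Cardinal.lift.{u, w} (Algebra.trdeg K (IntermediateField.adjoin K (Set.range x))) =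
      Cardinal.lift.{w, u} (Cardinal.mk ι) := by
  set E := IntermediateField.adjoin K (Set.range x)
  let y : ι → E := fun i => ⟨x i, IntermediateField.subset_adjoin K _ ⟨i, rfl⟩⟩
  have hy : AlgebraicIndependent K y := AlgebraicIndependent.of_comp E.val hx
  have htop : IntermediateField.adjoin K (Set.range y) = ⊤ := by
    refine IntermediateField.lift_injective E ?_
    rw [IntermediateField.lift_adjoin, IntermediateField.lift_top, ← Set.range_comp]
    rfl
  have hbasis : IsTranscendenceBasis K y := by
    rw [hy.isTranscendenceBasis_iff_isAlgebraic]
    refine ⟨fun z => IntermediateField.isAlgebraic_adjoin_iff.1 ?_⟩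
    have hz : z ∈ IntermediateField.adjoin K (Set.range y) := htop ▸ IntermediateField.mem_top
    exact isAlgebraic_algebraMap (⟨z, hz⟩ : IntermediateField.adjoin K (Set.range y))
  exact hbasis.lift_cardinalMk_eq_trdeg.symm

theorem algebraicIndependent_sternSeries {F : ℂ⟦X⟧} (hF₀ : F ≠ 0)
    (hF : DilcherStolarskyEquation F) :
    AlgebraicIndependent (Polynomial ℂ) ![sternSeries, F] := by
  rw [hF.eq_smul]
  have hc : coeff 0 F ≠ 0 := fun h => hF₀ (by rw [hF.eq_smul, h, zero_smul])
  set c := coeff 0 F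
  refine algebraicIndependent_of_hasGrowthRatio (x := fun n => (radialPoint n : ℂ)) (a := 1)
    (v := ![fun n => natSeriesSum stern (radialPoint n),
      fun n => c • (natSeriesSum dilcherStolarskyCoeff (radialPoint n) : ℂ)])
    (l := ![9, Real.goldenRatio ^ 2]) (mod_cast tendsto_radialPoint.ofReal)
    (mod_cast hasGrowthRatio_radialPoint_sub_one.ofReal) ?_ ?_ ?_
  · simp only [Fin.forall_fin_two]
    exact ⟨fun n => sternSeries_mem_evalGraph (norm_radialPoint_lt_one n), fun n =>
      Subalgebra.smul_mem _ (dilcherStolarskySeries_mem_evalGraph (norm_radialPoint_lt_one n)) c⟩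
  · simp only [Fin.forall_fin_two]
    refine ⟨hasGrowthRatio_stern.ofReal, ?_⟩
    simpa using (HasGrowthRatio.of_tendsto hc tendsto_const_nhds).mul
      hasGrowthRatio_dilcherStolarskyCoeff.ofReal
  · intro m m' d d' h
    simp only [Finsupp.prod_fintype, pow_zero, implies_true, Fin.prod_univ_two] at h
    obtain ⟨h₀, h₁⟩ := eq_and_eq_of_four_nine_goldenRatio h
    exact Finsupp.ext (Fin.forall_fin_two.2 ⟨h₀, h₁⟩)

theorem mainTheorem7_general :
    (X * sternSeries - (1 + X + X ^ 2) * expand 2 (by norm_num) sternSeries = 0) ∧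
    (∃! F : ℂ⟦X⟧, IsDilcherStolarsky F) ∧
    ∀ F : ℂ⟦X⟧, F ≠ 0 → DilcherStolarskyEquation F →
      AlgebraicIndependent (RatFunc ℂ)
        ![algebraMap ℂ⟦X⟧ ℂ⸨X⸩ sternSeries, algebraMap ℂ⟦X⟧ ℂ⸨X⸩ F] ∧
      Algebra.trdeg (RatFunc ℂ)
        (IntermediateField.adjoin (RatFunc ℂ)
          {algebraMap ℂ⟦X⟧ ℂ⸨X⸩ sternSeries, algebraMap ℂ⟦X⟧ ℂ⸨X⸩ F}) = 2 := by
  refine ⟨sternSeries_functional_equation, existsUnique_isDilcherStolarsky, fun F hF₀ hF => ?_⟩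
  have : IsScalarTower (Polynomial ℂ) ℂ⟦X⟧ ℂ⸨X⸩ := .of_algebraMap_eq fun _ => rfl
  have hindep := algebraicIndependent_algebraMap_comp_of_isFractionRing (Polynomial ℂ) (RatFunc ℂ)
    ℂ⟦X⟧ ℂ⸨X⸩ HahnSeries.ofPowerSeries_injective (algebraicIndependent_sternSeries hF₀ hF)
  have hcomp : algebraMap ℂ⟦X⟧ ℂ⸨X⸩ ∘ ![sternSeries, F] =
      ![algebraMap ℂ⟦X⟧ ℂ⸨X⸩ sternSeries, algebraMap ℂ⟦X⟧ ℂ⸨X⸩ F] :=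
    (FinVec.map_eq _ _).symm
  rw [hcomp] at hindep
  have htrdeg := trdeg_adjoin_range_of_algebraicIndependent hindep
  rw [Matrix.range_cons_cons_empty] at htrdeg
  exact ⟨hindep, by simpa using htrdeg⟩

theorem mainTheorem7 :
    (X * sternSeries - (1 + X + X ^ 2) * expand 2 (by norm_num) sternSeries = 0) ∧
    (∃! F : ℂ⟦X⟧, IsDilcherStolarsky F) ∧
    ∀ F : ℂ⟦X⟧, IsDilcherStolarsky F →
      AlgebraicIndependent (RatFunc ℂ)
        ![algebraMap ℂ⟦X⟧ ℂ⸨X⸩ sternSeries, algebraMap ℂ⟦X⟧ ℂ⸨X⸩ F] ∧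
      Algebra.trdeg (RatFunc ℂ)
        (IntermediateField.adjoin (RatFunc ℂ)
          {algebraMap ℂ⟦X⟧ ℂ⸨X⸩ sternSeries, algebraMap ℂ⟦X⟧ ℂ⸨X⸩ F}) = 2 :=
  let ⟨hS, hF, h⟩ := mainTheorem7_general
  ⟨hS, hF, fun F hF => h F hF.1 hF.2.2⟩
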